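/- Let $p$ be a prime, $a,\ell\ge 1$, and let $GR(p^a,\ell)=\mathbb{Z}_{p^a}[x]/(h(x))$ be the Galois ring, where $h\in\mathbb{Z}_{p^a}[x]$ is monic of degree $\ell$ and irreducible modulo $p$. Let $\gamma\in GR(p^a,\ell)$ have multiplicative order $p^\ell-1$, let $m,N\ge 1$, $n=mN\le p^\ell-1$ and $1\le k\le n$. The $m$-folded Reed-Solomon code $\mathcal{C}\subseteq (GR(p^a,\ell)^m)^N$ is the set of all words $$\Bigl(\bigl(f(\gamma^{im}),f(\gamma^{im+1}),\ldots,f(\gamma^{im+m-1})\bigr)\Bigr)_{0\le i<N},\qquad f\in GR(p^a,\ell)[X],\ \deg f<k .$$ Let $R=\frac{1}{N}\log_{|GR(p^a,\ell)^m|}|\mathcal{C}|$ be its rate (which equals $k/n$), and for a word $\vec y\in (GR(p^a,\ell)^m)^N$ and a real $\delta$ let $\mathcal{L}(\vec y,\delta)$ be the list of all codewords $c\in\mathcal{C}$ whose Hamming distance from $\vec y$, over the alphabet $GR(p^a,\ell)^m$, is less than $\delta N$. (1) For every integer $b$ with $1\le b\le m$ and every $\vec y\in (GR(p^a,\ell)^m)^N$,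 $$\Bigl|\mathcal{L}\Bigl(\vec y,\ \frac{b}{b+1}\Bigl(1-\frac{m}{m-b+1}R\Bigr)\Bigr)\Bigr|\le (b-1)^2+1 .$$ (2) Consequently the list size at distance $\varepsilon$ from the Singleton bound is $O(1/\varepsilon^2)$: there are absolute constants $c,K>0$ such that for every $\varepsilon>0$, every code $\mathcal{C}$ as above (for any $p,a,\ell,h,\gamma,N,k$) whose folding parameter satisfies $m\ge c/\varepsilon^2$, and every $\vec y$, $$|\mathcal{L}(\vec y,\,1-R-\varepsilon)|\le \frac{K}{\varepsilon^2}.$$ -/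

import Mathlib

open Polynomial

/-- `h ∈ ℤ_{p^a}[x]` is a monic basic irreducible polynomial of degree `ℓ`: it is monic of degree
`ℓ`, and its reduction modulo `p` is irreducible over `𝔽_p`. -/
structure IsMonicBasicIrreducible (p a ℓ : ℕ) (ha : 1 ≤ a) (h : (ZMod (p ^ a))[X]) : Prop where
  monic : h.Monic
  natDegree_eq : h.natDegree = ℓ
  irreducible_mod : Irreducible
    (h.map (ZMod.castHom (dvd_pow_self p (Nat.one_le_iff_ne_zero.mp ha)) (ZMod p)))

/-- The residue class ring `ℤ_{p^a}[x] / (h)`. When `h` is a monic basic irreducible polynomial of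
degree `ℓ`, this is the Galois ring `GR(p^a, ℓ)`. -/
abbrev GaloisRing (p a : ℕ) (h : (ZMod (p ^ a))[X]) : Type := AdjoinRoot h

/-- Encoding map of the `m`-folded Reed-Solomon code with `N` blocks: for `0 ≤ i < N`, `0 ≤ j < m`,
the `j`-th entry of the `i`-th symbol of the codeword of `f` is `f (γ ^ (i m + j))`. -/
def frsEncode {R : Type*} [CommRing R] (γ : R) (m N : ℕ) (f : R[X]) : Fin N → Fin m → R :=
  fun i j => f.eval (γ ^ ((i : ℕ) * m + (j : ℕ)))

/-- The `m`-folded Reed-Solomon code of block length `N`: the encodings of all the polynomials of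
degree less than `k`. -/
def frsCode {R : Type*} [CommRing R] (γ : R) (m N k : ℕ) : Set (Fin N → Fin m → R) :=
  frsEncode γ m N '' {f : R[X] | f.degree < (k : WithBot ℕ)}

/-- The rate `log_{|A|} |C| / N` of a code `C ⊆ A ^ N`. -/
noncomputable def codeRate {A : Type*} {N : ℕ} (C : Set (Fin N → A)) : ℝ :=
  Real.logb (Nat.card A : ℝ) (C.ncard : ℝ) / (N : ℝ)

open scoped Classical in
/-- The list of the codewords of `C ⊆ A ^ N` whose relative Hamming distance from the word `y` is
less than `δ`. -/
noncomputable def decodingList {A : Type*} {N : ℕ} (C : Set (Fin N → A)) (y : Fin N → A) (δ : ℝ) :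
    Set (Fin N → A) :=
  {c ∈ C | (hammingDist y c : ℝ) < δ * (N : ℝ)}

/-! Let `R` be the Galois ring, `F` its residue field and `μ = m - b + 1`. The field argument for
folded Reed-Solomon codes is interpolation followed by a subspace design bound; dimension counts,
which fail over `R`, are moved to `F` through the socle.

Interpolation gives an equation `A₀ + ∑ A_s f(γ^s X) = 0` satisfied by every listed polynomial
(`exists_dilation_equation`). Divisibility in `R` is total, so the linear system has a solution with
a coordinate `1`, and the equation stays nontrivial modulo `p`. Differences of listed polynomials
therefore lie in the module `M` of solutions of the homogeneous equation.

Let `z` generate the annihilator of `p`. Multiplication by `z` identifies `F[X]` with `z R[X]`, so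
`M ∩ z R[X]` becomes a subspace of `F[X]`, the socle reduction. It vanishes only if `M` does, it
respects vanishing on blocks, and it solves the reduced equation, so its dimension is at most `b -
1` (`finrank_dilationSolutions_lt`).

Induction on that dimension `d` bounds the list by `(b - 1) d + 1` (`card_le_of_sub_mem`):
agreements with the received word are counted block by block, and the folded Wronskian bounds the
total dimension of the pieces vanishing on the blocks (`sum_finrank_inf_blockVanishing_le`). Taking
`b` about `2 / ε` gives the second claim. -/

theorem coeff_mul_add_of_coeff_lt {R : Type*} [Semiring R] {p q : R[X]} {e j : ℕ}
    (hp : ∀ i < e, p.coeff i = 0) (hq : ∀ i < j, q.coeff i = 0) :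
    (p * q).coeff (e + j) = p.coeff e * q.coeff j := by
  rw [coeff_mul, Finset.sum_eq_single (e, j)]
  · rintro ⟨x, y⟩ hxy hne
    replace hxy : x + y = e + j := by simpa using hxy
    simp only
    rcases lt_trichotomy x e with h | h | h
    · simp [hp x h]
    · exact absurd (Prod.ext h (by simp only; omega)) hne
    · simp [hq y (by omega)]
  · intro h
    simp at h

/-- The polynomials `f` of degree less than `k` with `∑ s, A s * f (g ^ s * X) = 0`. -/
noncomputable def dilationSolutions {R : Type*} [CommRing R] (g : R) {b : ℕ} (A : Fin b → R[X])
    (k : ℕ) : Submodule R R[X] where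
  carrier := {f | f.degree < (k : WithBot ℕ) ∧
    ∑ s : Fin b, A s * f.comp (C (g ^ (s : ℕ)) * X) = 0}
  zero_mem' := by simp
  add_mem' := by
    rintro f f' ⟨h1, h2⟩ ⟨h3, h4⟩
    refine ⟨(degree_add_le _ _).trans_lt (max_lt h1 h3), ?_⟩
    simp only [add_comp, mul_add, Finset.sum_add_distrib, h2, h4, add_zero]
  smul_mem' := by
    rintro c f ⟨h1, h2⟩
    refine ⟨(degree_smul_le _ _).trans_lt h1, ?_⟩
    simp only [smul_comp, mul_smul_comm, ← Finset.smul_sum, h2, smul_zero]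

theorem dilationSolutions_le_degreeLT {R : Type*} [CommRing R] (g : R) {b : ℕ} (A : Fin b → R[X])
    (k : ℕ) : dilationSolutions g A k ≤ degreeLT R k :=
  fun _ hf => mem_degreeLT.2 hf.1

theorem block_index_lt {m N i r : ℕ} (hi : i < N) (hr : r < m) : i * m + r < m * N := by
  have := Nat.mul_le_mul_right m (Nat.succ_le_of_lt hi)
  rw [Nat.succ_mul, Nat.mul_comm N m] at this
  omega

theorem block_index_injective {m i i' r r' : ℕ} (hr : r < m) (hr' : r' < m)
    (h : i * m + r = i' * m + r') : i = i' ∧ r = r' := by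
  have h2 := congrArg (· % m) h
  simp only [Nat.mul_add_mod', Nat.mod_eq_of_lt hr, Nat.mod_eq_of_lt hr'] at h2
  exact ⟨Nat.eq_of_mul_eq_mul_right (by omega) (by omega : i * m = i' * m), h2⟩

/-! ### Dilation equations, folded Wronskians and subspace designs over a field -/

section Field

variable {F : Type*} [Field F]

/-- If `X^e` is the lowest power occurring in the `A s`, the lowest term `f_j X^j` of a nonzero
solution satisfies `P(g^j) f_j = 0`, where `P = ∑ s, (A s)_e Y^s` is nonzero of degree less than
`b`. So `j` is one of fewer than `b` exponents, and the coefficients at these exponents determine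
the solution. -/
theorem finrank_dilationSolutions_lt {g : F} {b k : ℕ} (hg : Set.InjOn (g ^ ·) (Set.Iio k))
    {A : Fin b → F[X]} (hA : A ≠ 0) : Module.finrank F (dilationSolutions g A k) < b := by
  classical
  have hex : ∃ e s, (A s).coeff e ≠ 0 := by
    obtain ⟨s, hs⟩ := Function.ne_iff.1 hA
    obtain ⟨e, he⟩ := Polynomial.ext_iff.not.1 hs |> not_forall.1
    exact ⟨e, s, by simpa using he⟩
  set e := Nat.find hex with he
  obtain ⟨s₀, hs₀⟩ := Nat.find_spec hex
  have hlow : ∀ s, ∀ i < e, (A s).coeff i = 0 := by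
    intro s i hi
    have := Nat.find_min hex hi
    push Not at this
    exact this s
  set P : F[X] := ∑ s : Fin b, C ((A s).coeff e) * X ^ (s : ℕ) with hP
  have hPc : P.coeff (s₀ : ℕ) = (A s₀).coeff e := by
    rw [hP, finsetSum_coeff, Finset.sum_eq_single s₀]
    · simp
    · intro s _ hs
      rw [coeff_C_mul_X_pow, if_neg]
      exact fun h => hs (Fin.ext h.symm)
    · simp
  have hP0 : P ≠ 0 := by
    intro h
    rw [h] at hPc
    exact hs₀ (by simpa using hPc.symm)
  have hPdeg : P.natDegree < b := by
    have : P.degree < b := by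
      refine (degree_sum_le _ _).trans_lt ?_
      refine (Finset.sup_lt_iff (WithBot.bot_lt_coe b)).2 ?_
      intro s _
      exact (degree_C_mul_X_pow_le _ _).trans_lt (WithBot.coe_lt_coe.2 s.2)
    exact (natDegree_lt_iff_degree_lt hP0).2 this
  set B : Finset ℕ := (Finset.range k).filter (fun j => P.eval (g ^ j) = 0) with hB
  have hBcard : B.card ≤ P.natDegree := by
    have h1 : (B.image (g ^ ·)).card = B.card := by
      apply Finset.card_image_of_injOn
      intro x hx y hy hxy
      simp only [hB, Finset.coe_filter, Finset.mem_range, Set.mem_ofPred_eq] at hx hy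
      exact hg hx.1 hy.1 hxy
    rw [← h1]
    apply card_le_degree_of_subset_roots
    intro x hx
    simp only [Finset.mem_val, Finset.mem_image, hB, Finset.mem_filter] at hx
    obtain ⟨j, ⟨-, hj⟩, rfl⟩ := hx
    exact (mem_roots hP0).2 hj
  let T : dilationSolutions g A k →ₗ[F] (B → F) :=
    { toFun := fun f j => f.1.coeff j
      map_add' := by intros; ext; simp
      map_smul' := by intros; ext; simp }
  have hT : Function.Injective T := by
    rw [injective_iff_map_eq_zero]
    rintro ⟨f, hfdeg, hf⟩ hTf
    by_contra hne
    have hf0 : f ≠ 0 := fun h => hne (by simp [h])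
    set j := f.natTrailingDegree with hj
    have hfj : f.coeff j ≠ 0 := by
      exact trailingCoeff_nonzero_iff_nonzero.2 hf0
    have hjk : j < k := by
      have h1 : f.natDegree < k := (natDegree_lt_iff_degree_lt hf0).2 hfdeg
      exact (natTrailingDegree_le_natDegree f).trans_lt h1
    have hc := congrArg (fun q => q.coeff (e + j)) hf
    simp only [finsetSum_coeff, coeff_zero] at hc
    have hc2 : P.eval (g ^ j) * f.coeff j = 0 := by
      rw [← hc, hP, eval_finsetSum, Finset.sum_mul]
      refine Finset.sum_congr rfl fun s _ => ?_
      rw [coeff_mul_add_of_coeff_lt (hlow s), comp_C_mul_X_coeff]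
      · simp only [eval_mul, eval_C, eval_pow, eval_X, ← pow_mul, mul_comm j]
        ring
      · intro i hi
        rw [comp_C_mul_X_coeff, coeff_eq_zero_of_lt_natTrailingDegree hi, zero_mul]
    have hjB : j ∈ B := by
      simp only [hB, Finset.mem_filter, Finset.mem_range]
      exact ⟨hjk, (mul_eq_zero.1 hc2).resolve_right hfj⟩
    exact hfj (congrFun hTf ⟨j, hjB⟩)
  have := LinearMap.finrank_le_finrank_of_injective hT
  simp only [Module.finrank_fintype_fun_eq_card, Fintype.card_coe] at this
  omega

/-- The folded Wronskian matrix `(f_j (g ^ s * X))_{s, j}`. -/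
noncomputable def foldedWronskian (g : F) {d : ℕ} (v : Fin d → F[X]) :
    Matrix (Fin d) (Fin d) F[X] :=
  Matrix.of fun s j => (v j).comp (C (g ^ (s : ℕ)) * X)

/-- A vanishing determinant yields a row relation, that is, a nonzero dilation equation with `d`
terms solved by all the `v j`; its solution space has dimension less than `d`. -/
theorem det_foldedWronskian_ne_zero {g : F} {d k : ℕ} (hg : Set.InjOn (g ^ ·) (Set.Iio k))
    {v : Fin d → F[X]} (hv : LinearIndependent F v) (hk : ∀ j, (v j).degree < (k : WithBot ℕ)) :
    (foldedWronskian g v).det ≠ 0 := by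
  intro h0
  obtain ⟨A, hA, hmul⟩ := Matrix.exists_vecMul_eq_zero_iff.2 h0
  have hlt := finrank_dilationSolutions_lt hg hA
  have hsub : Submodule.span F (Set.range v) ≤ dilationSolutions g A k := by
    rw [Submodule.span_le]
    rintro _ ⟨j, rfl⟩
    exact ⟨hk j, congrFun hmul j⟩
  have hfin : FiniteDimensional F (dilationSolutions g A k) := by
    have : FiniteDimensional F (degreeLT F k) :=
      Module.Finite.equiv (degreeLTEquiv F k).symm
    exact Submodule.finiteDimensional_of_le (dilationSolutions_le_degreeLT g A k)
  have := Submodule.finrank_mono hsub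
  rw [finrank_span_eq_card hv, Fintype.card_fin] at this
  omega

theorem natDegree_det_foldedWronskian_le (g : F) {d k : ℕ} {v : Fin d → F[X]}
    (hk : ∀ j, (v j).degree < (k : WithBot ℕ)) :
    (foldedWronskian g v).det.natDegree ≤ d * k := by
  rw [Matrix.det_apply]
  refine natDegree_sum_le_of_forall_le _ _ fun σ _ => ?_
  refine (natDegree_smul_le _ _).trans ((natDegree_prod_le _ _).trans ?_)
  refine (Finset.sum_le_card_nsmul _ _ k fun j _ => ?_).trans (by simp)
  have hvk : (v j).natDegree ≤ k := natDegree_le_of_degree_le (hk j).le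
  have h1 : (C (g ^ (σ j : ℕ)) * X : F[X]).natDegree ≤ 1 := (natDegree_C_mul_le _ _).trans natDegree_X_le
  refine natDegree_comp_le.trans ?_
  nlinarith

/-- Dilation is `F`-linear, so expressing `v` through `w` multiplies the Wronskian on the right by a
matrix of constants. -/
theorem det_foldedWronskian_dvd (g : F) {d : ℕ} {v w : Fin d → F[X]}
    (h : ∀ j, v j ∈ Submodule.span F (Set.range w)) :
    (foldedWronskian g w).det ∣ (foldedWronskian g v).det := by
  have h' : ∀ j, ∃ c : Fin d → F, ∑ i, c i • w i = v j := fun j =>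
    (Submodule.mem_span_range_iff_exists_fun F).1 (h j)
  choose c hc using h'
  have : foldedWronskian g v =
      foldedWronskian g w * Matrix.of (fun i j => C (c j i)) := by
    ext1 s j
    simp only [foldedWronskian, Matrix.mul_apply, Matrix.of_apply]
    rw [← hc j, sum_comp]
    refine Finset.sum_congr rfl fun i _ => ?_
    rw [smul_comp, smul_eq_C_mul, mul_comm]
  rw [this, Matrix.det_mul]
  exact dvd_mul_right _ _

theorem pow_card_dvd_det {ι A : Type*} [Fintype ι] [DecidableEq ι] [CommRing A]
    (N : Matrix ι ι A) (q : A) (S : Finset ι) (h : ∀ i, ∀ j ∈ S, q ∣ N i j) :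
    q ^ S.card ∣ N.det := by
  rw [Matrix.det_apply]
  refine Finset.dvd_sum fun σ _ => ?_
  refine (Dvd.dvd.mul_left ?_ _).trans (by rw [Units.smul_def, zsmul_eq_mul])
  calc q ^ S.card = ∏ j, if j ∈ S then q else 1 := by simp [Finset.prod_ite_mem]
    _ ∣ _ := Finset.prod_dvd_prod_of_dvd _ _ fun j _ => by
      split_ifs with hj
      · exact h _ _ hj
      · exact one_dvd _

/-- The polynomials vanishing at `g ^ (i * m + j)` for all `j < m`. -/
noncomputable def blockVanishing {R : Type*} [CommRing R] (g : R) (m i : ℕ) : Submodule R R[X] where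
  carrier := {f | ∀ j < m, f.eval (g ^ (i * m + j)) = 0}
  zero_mem' := by simp
  add_mem' := by
    intro f f' h h' j hj
    simp [h j hj, h' j hj]
  smul_mem' := by
    intro c f h j hj
    simp [h j hj]

theorem pow_finrank_dvd_det_foldedWronskian {g : F} {d m i r : ℕ} (hr : r + d ≤ m)
    {W : Submodule F F[X]} (v : Module.Basis (Fin d) F W) :
    (X - C (g ^ (i * m + r))) ^ Module.finrank F (W ⊓ blockVanishing g m i : Submodule F F[X]) ∣
      (foldedWronskian g (fun j => (v j : F[X]))).det := by
  have hWfin : FiniteDimensional F W := Module.Basis.finiteDimensional_of_finite v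
  set U : Submodule F W := (blockVanishing g m i).comap W.subtype with hU
  have hfr : Module.finrank F (W ⊓ blockVanishing g m i : Submodule F F[X]) =
      Module.finrank F U := by
    rw [← Submodule.finrank_map_subtype_eq W U, hU, Submodule.map_comap_subtype]
  have : Module.Free F U := Module.Free.of_divisionRing F U
  obtain ⟨U', hU'⟩ := Submodule.exists_isCompl U
  have : Module.Free F U' := Module.Free.of_divisionRing F U'
  -- In a basis adapted to `U`, the columns coming from `U` vanish at `g ^ (i * m + r)`: row `s`
  -- evaluates at offset `r + s < m` of the same block.
  let b₀ := ((Module.finBasis F U).prod (Module.finBasis F U')).map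
    (Submodule.prodEquivOfIsCompl U U' hU')
  let eqv := b₀.indexEquiv v
  let w := b₀.reindex eqv
  let S : Finset (Fin d) := Finset.univ.map
    (⟨fun t => eqv (Sum.inl t), eqv.injective.comp Sum.inl_injective⟩ :
      Fin (Module.finrank F U) ↪ Fin d)
  have hS : S.card = Module.finrank F U := by simp [S]
  have hdvd : (foldedWronskian g (fun j => (w j : F[X]))).det ∣
      (foldedWronskian g (fun j => (v j : F[X]))).det := by
    refine det_foldedWronskian_dvd g fun j => ?_
    have h1 : v j ∈ Submodule.span F (Set.range w) := by simp [w.span_eq]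
    have h2 := Submodule.mem_map_of_mem (f := W.subtype) h1
    rw [Submodule.map_span, ← Set.range_comp] at h2
    exact h2
  refine Dvd.dvd.trans ?_ hdvd
  rw [hfr, ← hS]
  refine pow_card_dvd_det _ _ S fun s j hj => ?_
  obtain ⟨t, -, rfl⟩ := Finset.mem_map.1 hj
  have hw : w (eqv (Sum.inl t)) = (Module.finBasis F U t : W) := by
    simp [w, b₀, Module.Basis.reindex_apply]
  simp only [foldedWronskian, Matrix.of_apply, Function.Embedding.coeFn_mk]
  rw [hw, dvd_iff_isRoot, IsRoot.def, eval_comp]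
  have hmem : ((Module.finBasis F U t : W) : F[X]) ∈ blockVanishing g m i :=
    (Module.finBasis F U t).2
  have := hmem (r + s) (by omega)
  simp only [eval_mul, eval_C, eval_X, ← pow_add]
  convert this using 3
  ring

/-- The subspace design property of folded Reed-Solomon codes. -/
theorem sum_finrank_inf_blockVanishing_le {g : F} {m N k : ℕ}
    (hg : Set.InjOn (g ^ ·) (Set.Iio (m * N))) (hkn : k ≤ m * N)
    {W : Submodule F F[X]} (hW : W ≤ degreeLT F k) {d : ℕ} (hd : Module.finrank F W = d)
    (hdm : d ≤ m) :
    (m - d + 1) * ∑ i : Fin N, Module.finrank F (W ⊓ blockVanishing g m i : Submodule F F[X]) ≤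
      d * k := by
  rcases Nat.eq_zero_or_pos d with rfl | hd0
  · have hz : ∀ i : Fin N,
        Module.finrank F (W ⊓ blockVanishing g m i : Submodule F F[X]) = 0 := by
      intro i
      have : FiniteDimensional F (degreeLT F k) :=
        Module.Finite.equiv (degreeLTEquiv F k).symm
      have : FiniteDimensional F W := Submodule.finiteDimensional_of_le hW
      have := Submodule.finrank_mono (inf_le_left : W ⊓ blockVanishing g m i ≤ W)
      omega
    simp [hz]
  have : FiniteDimensional F (degreeLT F k) := Module.Finite.equiv (degreeLTEquiv F k).symm
  have hWfin : FiniteDimensional F W := Submodule.finiteDimensional_of_le hW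
  let v : Module.Basis (Fin d) F W := Module.finBasisOfFinrankEq F W hd
  have hvdeg : ∀ j, ((v j : W) : F[X]).degree < (k : WithBot ℕ) := fun j =>
    mem_degreeLT.1 (hW (v j).2)
  set D := (foldedWronskian g (fun j => (v j : F[X]))).det with hD
  have hD0 : D ≠ 0 := by
    refine det_foldedWronskian_ne_zero (hg.mono fun x hx => lt_of_lt_of_le hx hkn) ?_ hvdeg
    exact v.linearIndependent.map' W.subtype (Submodule.ker_subtype W)
  have hDdeg : D.natDegree ≤ d * k := natDegree_det_foldedWronskian_le g hvdeg
  let e : Fin N → ℕ := fun i => Module.finrank F (W ⊓ blockVanishing g m i : Submodule F F[X])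
  -- Each of the `m - d + 1` admissible offsets in block `i` is a root of `D` of multiplicity at
  -- least `e i`, and these points are distinct; comparison with `deg D ≤ d * k` gives the bound.
  have hprod : ∏ x : Fin N × Fin (m - d + 1), (X - C (g ^ ((x.1 : ℕ) * m + x.2))) ^ e x.1 ∣ D := by
    refine Finset.prod_dvd_of_coprime ?_ ?_
    · rintro ⟨i, r⟩ - ⟨i', r'⟩ - hne
      refine IsCoprime.pow (pairwise_coprime_X_sub_C (s := (id : F → F))
        Function.injective_id fun h => hne ?_)
      have hr : (r : ℕ) < m := by omega
      have hr' : (r' : ℕ) < m := by omega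
      have h1 := hg (block_index_lt i.2 hr) (block_index_lt i'.2 hr') h
      have h2 := block_index_injective hr hr' h1
      exact Prod.ext (Fin.ext h2.1) (Fin.ext h2.2)
    · rintro ⟨i, r⟩ -
      exact pow_finrank_dvd_det_foldedWronskian (by omega) v
  have hle := natDegree_le_of_dvd hprod hD0
  rw [natDegree_prod_of_monic _ _ fun x _ => (monic_X_sub_C _).pow _] at hle
  simp only [natDegree_pow, natDegree_X_sub_C, mul_one, Fintype.sum_prod_type,
    Finset.sum_const, Finset.card_univ, Fintype.card_fin, smul_eq_mul, ← Finset.mul_sum] at hle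
  exact hle.trans hDdeg

end Field

/-! ### Linear systems over rings with total divisibility -/

/-- Over a ring whose divisibility relation is total, a homogeneous linear system with more
unknowns than equations has a solution with a coordinate equal to `1`. -/
theorem exists_fin_solution_of_dvd_total {R : Type*} [CommRing R] (htot : ∀ a b : R, a ∣ b ∨ b ∣ a)
    {m n : ℕ} (hmn : m < n) (A : Fin m → Fin n → R) :
    ∃ v : Fin n → R, (∀ q, ∑ i, A q i * v i = 0) ∧ ∃ i, v i = 1 := by
  induction m generalizing n with
  | zero => exact ⟨fun _ => 1, fun q => q.elim0, ⟨0, hmn⟩, rfl⟩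
  | succ m ih =>
    obtain ⟨n, rfl⟩ : ∃ n', n = n' + 1 := ⟨n - 1, by omega⟩
    -- Gaussian elimination without inverses: an entry dividing its whole row serves as pivot. The
    -- eliminated unknown is appended to a smaller solution, whose coordinate `1` survives.
    obtain ⟨j, hj⟩ : ∃ j, ∀ i, A 0 j ∣ A 0 i := by
      have key : ∀ S : Finset (Fin (n + 1)), S.Nonempty → ∃ j, ∀ i ∈ S, A 0 j ∣ A 0 i := by
        intro S hS
        induction hS using Finset.Nonempty.cons_induction with
        | singleton a => exact ⟨a, by simp⟩
        | cons a S _ _ ihS =>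
          obtain ⟨j, hj⟩ := ihS
          rcases htot (A 0 a) (A 0 j) with h | h
          · refine ⟨a, fun i hi => ?_⟩
            rcases Finset.mem_cons.1 hi with rfl | hi
            · exact dvd_rfl
            · exact h.trans (hj i hi)
          · refine ⟨j, fun i hi => ?_⟩
            rcases Finset.mem_cons.1 hi with rfl | hi
            · exact h
            · exact hj i hi
      obtain ⟨j, hj⟩ := key Finset.univ Finset.univ_nonempty
      exact ⟨j, fun i => hj i (Finset.mem_univ i)⟩
    choose c hc using hj
    obtain ⟨w, hw, i₁, hi₁⟩ := ih (n := n) (by omega) fun q i =>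
      A q.succ (j.succAbove i) - A q.succ j * c (j.succAbove i)
    refine ⟨j.insertNth (-∑ i, c (j.succAbove i) * w i) w, fun q => ?_, j.succAbove i₁, by simpa⟩
    simp only [Fin.sum_univ_succAbove _ j, Fin.insertNth_apply_same,
      Fin.insertNth_apply_succAbove]
    refine Fin.cases ?_ (fun q => ?_) q
    · rw [mul_neg, Finset.mul_sum, neg_add_eq_zero]
      refine Finset.sum_congr rfl fun i _ => ?_
      rw [← mul_assoc, ← hc]
    · rw [← hw q, mul_neg, Finset.mul_sum, neg_add_eq_sub, ← Finset.sum_sub_distrib]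
      refine Finset.sum_congr rfl fun i _ => ?_
      ring

theorem exists_solution_of_dvd_total {R : Type*} [CommRing R] (htot : ∀ a b : R, a ∣ b ∨ b ∣ a)
    {ι κ : Type*} [Fintype ι] [Fintype κ] (hcard : Fintype.card κ < Fintype.card ι)
    (A : κ → ι → R) : ∃ v : ι → R, (∀ q, ∑ i, A q i * v i = 0) ∧ ∃ i, v i = 1 := by
  obtain ⟨v, hv, i, hi⟩ := exists_fin_solution_of_dvd_total htot hcard fun q i =>
    A ((Fintype.equivFin κ).symm q) ((Fintype.equivFin ι).symm i)
  refine ⟨fun i => v (Fintype.equivFin ι i), fun q => ?_, (Fintype.equivFin ι).symm i, by simpa⟩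
  rw [← hv (Fintype.equivFin κ q)]
  exact Fintype.sum_equiv (Fintype.equivFin ι) _ _ (by simp)

/-! ### Chain rings and their socle -/

/-- `φ` is the reduction of a ring onto its residue field, with kernel generated by a nilpotent
element `π`. -/
structure IsChainReduction {R F : Type*} [CommRing R] [Field F] (φ : R →+* F) (π : R) : Prop where
  surjective : Function.Surjective φ
  isNilpotent : IsNilpotent π
  map_eq_zero_iff : ∀ r, φ r = 0 ↔ π ∣ r

/-- `z` generates the socle: it is annihilated by exactly the multiples of `π`, and every element
annihilated by `π` is a multiple of `z`. -/
structure IsSocleGenerator {R F : Type*} [CommRing R] [Field F] (φ : R →+* F) (π z : R) :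
    Prop where
  mul_eq_zero_iff : ∀ r, z * r = 0 ↔ φ r = 0
  dvd_of_mul_eq_zero : ∀ r, π * r = 0 → z ∣ r

section Chain

variable {R F : Type*} [CommRing R] [Field F] {φ : R →+* F} {π z : R}

namespace IsChainReduction

theorem isUnit_of_map_ne_zero (h : IsChainReduction φ π) {r : R} (hr : φ r ≠ 0) : IsUnit r := by
  obtain ⟨s, hs⟩ := h.surjective (φ r)⁻¹
  have h1 : φ (r * s - 1) = 0 := by simp [hs, hr]
  obtain ⟨t, ht⟩ := (h.map_eq_zero_iff _).1 h1
  have h2 : IsNilpotent (r * s - 1) := ht ▸ (Commute.all π t).isNilpotent_mul_right h.isNilpotent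
  have h3 : IsUnit (r * s) := by simpa using h2.isUnit_add_one
  exact isUnit_of_mul_isUnit_left h3

theorem exists_eq_pow_mul (h : IsChainReduction φ π) (r : R) :
    ∃ e u, IsUnit u ∧ r = π ^ e * u := by
  classical
  obtain ⟨n, hn⟩ := h.isNilpotent
  rcases eq_or_ne r 0 with rfl | hr
  · exact ⟨n, 1, isUnit_one, by simp [hn]⟩
  have hex : ∃ e, ¬ π ^ e ∣ r := ⟨n, by rwa [hn, zero_dvd_iff]⟩
  obtain ⟨e, he⟩ : ∃ e, Nat.find hex = e + 1 := by
    refine Nat.exists_eq_succ_of_ne_zero fun h0 => ?_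
    have := Nat.find_spec hex
    rw [h0] at this
    simp at this
  have h1 : π ^ e ∣ r := not_not.1 (Nat.find_min hex (m := e) (by omega))
  have h2 : ¬ π ^ (e + 1) ∣ r := he ▸ Nat.find_spec hex
  obtain ⟨u, rfl⟩ := h1
  refine ⟨e, u, h.isUnit_of_map_ne_zero fun hu => h2 ?_, rfl⟩
  rw [pow_succ]
  exact mul_dvd_mul_left _ ((h.map_eq_zero_iff u).1 hu)

theorem dvd_total (h : IsChainReduction φ π) (a b : R) : a ∣ b ∨ b ∣ a := by
  obtain ⟨e, u, hu, rfl⟩ := h.exists_eq_pow_mul a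
  obtain ⟨e', u', hu', rfl⟩ := h.exists_eq_pow_mul b
  rw [hu.mul_right_dvd, hu'.mul_right_dvd]
  rcases le_total e e' with hle | hle
  · exact Or.inl ((pow_dvd_pow π hle).mul_right _)
  · exact Or.inr ((pow_dvd_pow π hle).mul_right _)

/-- The generator is the last nonzero power of `π`; it is `1` when `π = 0`. -/
theorem exists_isSocleGenerator (h : IsChainReduction φ π) : ∃ z, IsSocleGenerator φ π z := by
  classical
  have : Nontrivial R := φ.domain_nontrivial
  have hex : ∃ n, π ^ n = 0 := h.isNilpotent
  obtain ⟨a, ha⟩ : ∃ a, Nat.find hex = a + 1 := by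
    refine Nat.exists_eq_succ_of_ne_zero fun h0 => ?_
    have := Nat.find_spec hex
    rw [h0] at this
    simp at this
  have h1 : π ^ (a + 1) = 0 := ha ▸ Nat.find_spec hex
  have h2 : ∀ e, π ^ e = 0 → a + 1 ≤ e := fun e he => ha ▸ Nat.find_min' hex he
  refine ⟨π ^ a, fun r => ⟨fun hr => ?_, fun hr => ?_⟩, fun r hr => ?_⟩
  · by_contra hne
    have := h2 a ((h.isUnit_of_map_ne_zero hne).mul_left_eq_zero.1 hr)
    omega
  · obtain ⟨s, rfl⟩ := (h.map_eq_zero_iff r).1 hr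
    rw [← mul_assoc, ← pow_succ, h1, zero_mul]
  · obtain ⟨e, u, hu, rfl⟩ := h.exists_eq_pow_mul r
    rw [← mul_assoc, ← pow_succ', hu.mul_left_eq_zero] at hr
    exact (pow_dvd_pow π (by have := h2 _ hr; omega)).mul_right _

end IsChainReduction

namespace IsSocleGenerator

theorem map_eq_zero_of_C_mul_eq_zero (hz : IsSocleGenerator φ π z) {q : R[X]}
    (hq : C z * q = 0) : q.map φ = 0 := by
  ext i
  rw [coeff_map, coeff_zero, ← hz.mul_eq_zero_iff, ← coeff_C_mul, hq, coeff_zero]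

/-- The last power of `π` not killing `f` moves it into the socle: all coefficients of the product
are killed by `π`, hence are multiples of `z`. This is how a nonzero polynomial over `R` leaves a
nonzero trace over `F`. -/
theorem exists_C_mul_eq (h : IsChainReduction φ π) (hz : IsSocleGenerator φ π z) {f : R[X]}
    (hf : f ≠ 0) : ∃ r g, C z * g = C r * f ∧ g.map φ ≠ 0 := by
  classical
  have hex : ∃ e, C (π ^ e) * f = 0 := by
    obtain ⟨n, hn⟩ := h.isNilpotent
    exact ⟨n, by simp [hn]⟩
  obtain ⟨e, he⟩ : ∃ e, Nat.find hex = e + 1 := by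
    refine Nat.exists_eq_succ_of_ne_zero fun h0 => hf ?_
    have := Nat.find_spec hex
    rw [h0] at this
    simpa using this
  have h1 : C (π ^ e) * f ≠ 0 := Nat.find_min hex (m := e) (by omega)
  have h2 : C (π ^ (e + 1)) * f = 0 := he ▸ Nat.find_spec hex
  have h3 : C z ∣ C (π ^ e) * f := by
    rw [C_dvd_iff_dvd_coeff]
    intro i
    refine hz.dvd_of_mul_eq_zero _ ?_
    have := congrArg (fun q => q.coeff i) h2
    simp only [coeff_C_mul, coeff_zero] at this ⊢
    rw [← this]
    ring
  obtain ⟨g, hg⟩ := h3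
  refine ⟨π ^ e, g, hg.symm, fun h0 => h1 ?_⟩
  ext i
  rw [hg, coeff_C_mul, coeff_zero, hz.mul_eq_zero_iff, ← coeff_map, h0, coeff_zero]

/-- A nonzero `f` would give a nonzero polynomial over `F` with the same degree bound and with the
reductions of the `x i` as roots. Distinctness modulo `π` replaces the absence of zero divisors. -/
theorem eq_zero_of_degree_lt_card (h : IsChainReduction φ π) (hz : IsSocleGenerator φ π z)
    {f : R[X]} {ι : Type*} {S : Finset ι} {x : ι → R} (hx : Set.InjOn (fun i => φ (x i)) S)
    (hdeg : f.degree < S.card) (hf : ∀ i ∈ S, f.eval (x i) = 0) : f = 0 := by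
  by_contra hne
  obtain ⟨r, g, hg, hg0⟩ := hz.exists_C_mul_eq h hne
  refine hg0 (eq_zero_of_degree_lt_of_eval_index_eq_zero _ hx ?_ fun i hi => ?_)
  · rw [degree_lt_iff_coeff_zero]
    intro i hi
    rw [coeff_map, ← hz.mul_eq_zero_iff, ← coeff_C_mul, hg, coeff_C_mul,
      (degree_lt_iff_coeff_zero _ _).1 hdeg i hi, mul_zero]
  · rw [eval_map_apply, ← hz.mul_eq_zero_iff]
    simpa [hf i hi] using congrArg (eval (x i)) hg

end IsSocleGenerator

/-! ### Socle reduction of submodules of polynomials -/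

/-- The reductions modulo `π` of the polynomials `g` with `z * g ∈ M`. -/
noncomputable def socleReduction (hφ : Function.Surjective φ) (z : R) (M : Submodule R R[X]) :
    Submodule F F[X] where
  carrier := {q | ∃ g : R[X], g.map φ = q ∧ C z * g ∈ M}
  zero_mem' := ⟨0, by simp, by simp⟩
  add_mem' := by
    rintro _ _ ⟨g, rfl, hg⟩ ⟨g', rfl, hg'⟩
    exact ⟨g + g', by simp, by rw [mul_add]; exact M.add_mem hg hg'⟩
  smul_mem' := by
    rintro c _ ⟨g, rfl, hg⟩
    obtain ⟨r, rfl⟩ := hφ c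
    refine ⟨C r * g, by simp [smul_eq_C_mul], ?_⟩
    rw [mul_left_comm, ← smul_eq_C_mul]
    exact M.smul_mem r hg

theorem eq_bot_of_socleReduction_eq_bot (h : IsChainReduction φ π) (hz : IsSocleGenerator φ π z)
    {M : Submodule R R[X]} (hM : socleReduction h.surjective z M = ⊥) : M = ⊥ := by
  rw [eq_bot_iff]
  intro f hf
  by_contra hne
  obtain ⟨r, g, hg, hg0⟩ := hz.exists_C_mul_eq h (f := f) (by simpa using hne)
  have : g.map φ ∈ socleReduction h.surjective z M :=
    ⟨g, rfl, by rw [hg, ← smul_eq_C_mul]; exact M.smul_mem r hf⟩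
  rw [hM] at this
  exact hg0 (by simpa using this)

theorem socleReduction_mono (hφ : Function.Surjective φ) {M M' : Submodule R R[X]} (hM : M ≤ M') :
    socleReduction hφ z M ≤ socleReduction hφ z M' := by
  rintro _ ⟨g, rfl, hg⟩
  exact ⟨g, rfl, hM hg⟩

theorem socleReduction_degreeLT_le (hφ : Function.Surjective φ) (hz : IsSocleGenerator φ π z)
    (k : ℕ) : socleReduction hφ z (degreeLT R k) ≤ degreeLT F k := by
  rintro _ ⟨g, rfl, hg⟩
  rw [mem_degreeLT, degree_lt_iff_coeff_zero] at hg ⊢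
  intro i hi
  rw [coeff_map, ← hz.mul_eq_zero_iff, ← coeff_C_mul, hg i hi]

theorem socleReduction_blockVanishing_le (hφ : Function.Surjective φ)
    (hz : IsSocleGenerator φ π z) (γ : R) (m i : ℕ) :
    socleReduction hφ z (blockVanishing γ m i) ≤ blockVanishing (φ γ) m i := by
  rintro _ ⟨g, rfl, hg⟩ j hj
  rw [← map_pow, eval_map_apply, ← hz.mul_eq_zero_iff]
  simpa using hg j hj

theorem socleReduction_dilationSolutions_le (hφ : Function.Surjective φ)
    (hz : IsSocleGenerator φ π z) (γ : R) {b : ℕ} (A : Fin b → R[X]) (k : ℕ) :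
    socleReduction hφ z (dilationSolutions γ A k) ≤
      dilationSolutions (φ γ) (fun s => (A s).map φ) k := by
  rintro _ ⟨g, rfl, hdeg, hg⟩
  refine ⟨mem_degreeLT.1 (socleReduction_degreeLT_le hφ hz k ⟨g, rfl, mem_degreeLT.2 hdeg⟩), ?_⟩
  have h1 : C z * ∑ s : Fin b, A s * g.comp (C (γ ^ (s : ℕ)) * X) = 0 := by
    rw [← hg, Finset.mul_sum]
    refine Finset.sum_congr rfl fun s _ => ?_
    rw [mul_comp, C_comp]
    ring
  simpa [Polynomial.map_sum, map_comp] using hz.map_eq_zero_of_C_mul_eq_zero h1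

end Chain

/-! ### Agreement sets, interpolation and the list size bound -/

open scoped Classical in
/-- The blocks on which the encoding of `f` agrees with `y`. -/
noncomputable def agreement {R : Type*} [CommRing R] (γ : R) {m N : ℕ} (y : Fin N → Fin m → R)
    (f : R[X]) : Finset (Fin N) :=
  Finset.univ.filter fun i => frsEncode γ m N f i = y i

theorem mem_agreement {R : Type*} [CommRing R] {γ : R} {m N : ℕ} {y : Fin N → Fin m → R}
    {f : R[X]} {i : Fin N} : i ∈ agreement γ y f ↔ frsEncode γ m N f i = y i := by
  simp [agreement]

/-- Any nonempty list forces `k ≤ N * μ`. This makes the subtraction in the choice of the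
interpolation degree a true one, and closes the final count. -/
theorem le_mul_of_mul_add_lt {N μ b k a : ℕ} (h : N * μ + b * k < (b + 1) * (μ * a))
    (ha : a ≤ N) : k ≤ N * μ := by
  by_contra! hlt
  have h1 : (b + 1) * (μ * a) ≤ (b + 1) * (μ * N) := by gcongr
  have h2 : b * (N * μ) ≤ b * k := Nat.mul_le_mul_left b hlt.le
  linarith

section Chain

variable {R F : Type*} [CommRing R] [Field F] {φ : R →+* F} {π z : R}

/-- Polynomials whose encodings all have large agreement with `y` lie in a coset of the solutions
of a linear dilation equation that is nontrivial modulo `π`. -/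
theorem exists_dilation_equation (h : IsChainReduction φ π) (hz : IsSocleGenerator φ π z)
    {γ : R} {b μ m N k : ℕ} (hg : Set.InjOn (φ γ ^ ·) (Set.Iio (m * N))) (hk : 1 ≤ k)
    (hμ : μ + b = m + 1) (hb : 1 ≤ b) (y : Fin N → Fin m → R) {L : Finset R[X]}
    (hL0 : L.Nonempty) (hdeg : ∀ f ∈ L, f.degree < (k : WithBot ℕ))
    (hagr : ∀ f ∈ L, N * μ + b * k < (b + 1) * (μ * (agreement γ y f).card)) :
    ∃ A : Fin b → R[X], (fun s => (A s).map φ) ≠ 0 ∧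
      ∀ f ∈ L, ∀ f' ∈ L, f - f' ∈ dilationSolutions γ A k := by
  classical
  obtain ⟨f₀, hf₀⟩ := hL0
  have hkN : k ≤ N * μ := by
    have h1 := hagr f₀ hf₀
    have h2 : (agreement γ y f₀).card ≤ N := by simpa using Finset.card_le_univ (agreement γ y f₀)
    exact le_mul_of_mul_add_lt h1 h2
  -- Each `A s` gets `E` coefficients and `A₀` gets `E + k - 1`. `E` is the least value giving more
  -- unknowns than the `N * μ` equations, so that `E + k - 1` stays at most the number of agreement
  -- points.
  obtain ⟨E, hE1, hE2, hE3⟩ : ∃ E, 1 ≤ E ∧ N * μ < b * E + (E + k - 1) ∧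
      (b + 1) * (E + k - 1) ≤ N * μ + b * k + 1 := by
    obtain ⟨q, hq1, hq2⟩ : ∃ q, q * (b + 1) ≤ N * μ + 1 - k ∧
        N * μ + 1 - k < q * (b + 1) + (b + 1) :=
      ⟨_, Nat.div_mul_le_self _ (b + 1), Nat.lt_div_mul_add (by omega)⟩
    refine ⟨q + 1, by omega, ?_, ?_⟩
    · rw [mul_add, mul_one] at hq1 hq2 ⊢
      rw [mul_comm b q]
      omega
    · have e : (b + 1) * (q + 1 + k - 1) = q * (b + 1) + b * k + k := by
        rw [show q + 1 + k - 1 = q + k by omega]; ring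
      omega
  have hcard : Fintype.card (Fin N × Fin μ) <
      Fintype.card ((Fin b × Fin E) ⊕ Fin (E + k - 1)) := by simpa using hE2
  -- A window of `b` consecutive entries starting at an offset below `μ = m - b + 1` stays inside
  -- its block.
  have hrs : ∀ (r : Fin μ) (s : Fin b), (r : ℕ) + s < m := fun r s => by omega
  obtain ⟨v, hv, i₁, hi₁⟩ := exists_solution_of_dvd_total h.dvd_total hcard
    (fun (x : Fin N × Fin μ) => Sum.elim
      (fun st => (γ ^ ((x.1 : ℕ) * m + x.2)) ^ (st.2 : ℕ) * y x.1 ⟨_, hrs x.2 st.1⟩)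
      (fun t => (γ ^ ((x.1 : ℕ) * m + x.2)) ^ (t : ℕ)))
  let A₀ : R[X] := ofFn (E + k - 1) fun t => v (Sum.inr t)
  let A : Fin b → R[X] := fun s => ofFn E fun t => v (Sum.inl (s, t))
  have heval : ∀ (n : ℕ) (c : Fin n → R) (x : R), (ofFn n c).eval x = ∑ t : Fin n, x ^ (t : ℕ) * c t := by
    intro n c x
    simp [ofFn_eq_sum_monomial, eval_finsetSum, mul_comm]
  have hzero : ∀ f ∈ L, A₀ + ∑ s, A s * f.comp (C (γ ^ (s : ℕ)) * X) = 0 := by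
    intro f hf
    refine hz.eq_zero_of_degree_lt_card h
      (S := agreement γ y f ×ˢ (Finset.univ : Finset (Fin μ)))
      (x := fun x => γ ^ ((x.1 : ℕ) * m + x.2)) ?_ ?_ ?_
    · rintro ⟨i, r⟩ - ⟨i', r'⟩ - hxx
      have hr : (r : ℕ) < m := by omega
      have hr' : (r' : ℕ) < m := by omega
      simp only [map_pow] at hxx
      have h1 := hg (block_index_lt i.2 hr) (block_index_lt i'.2 hr') hxx
      have h2 := block_index_injective hr hr' h1
      exact Prod.ext (Fin.ext h2.1) (Fin.ext h2.2)
    · have hle : E + k - 1 ≤ (agreement γ y f ×ˢ (Finset.univ : Finset (Fin μ))).card := by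
        rw [Finset.card_product, Finset.card_univ, Fintype.card_fin]
        have h1 := hagr f hf
        rw [mul_comm μ] at h1
        exact Nat.le_of_mul_le_mul_left (hE3.trans h1) (by omega)
      refine lt_of_lt_of_le ?_ (WithBot.coe_le_coe.2 hle)
      refine (degree_add_le _ _).trans_lt (max_lt (ofFn_degree_lt _) ?_)
      refine (degree_sum_le _ _).trans_lt ?_
      refine (Finset.sup_lt_iff (WithBot.bot_lt_coe _)).2 fun s _ => ?_
      have h1 : (A s).natDegree ≤ E - 1 := by
        have := ofFn_natDegree_lt hE1 fun t => v (Sum.inl (s, t))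
        change (ofFn E fun t => v (Sum.inl (s, t))).natDegree ≤ _
        omega
      have h2 : (f.comp (C (γ ^ (s : ℕ)) * X)).natDegree ≤ k - 1 := by
        refine natDegree_comp_le.trans ?_
        have h3 : (C (γ ^ (s : ℕ)) * X : R[X]).natDegree ≤ 1 :=
          (natDegree_C_mul_le _ _).trans natDegree_X_le
        have h4 : f.natDegree ≤ k - 1 := by
          rcases eq_or_ne f 0 with rfl | hf0
          · simp
          · have := (natDegree_lt_iff_degree_lt hf0).2 (hdeg f hf)
            omega
        nlinarith
      refine (degree_le_of_natDegree_le (natDegree_mul_le.trans (add_le_add h1 h2))).trans_lt ?_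
      exact WithBot.coe_lt_coe.2 (by omega : E - 1 + (k - 1) < E + k - 1)
    · rintro ⟨i, r⟩ hir
      have hi : frsEncode γ m N f i = y i := mem_agreement.1 (Finset.mem_product.1 hir).1
      have h1 := hv (i, r)
      simp only [Fintype.sum_sum_type, Sum.elim_inl, Sum.elim_inr, Fintype.sum_prod_type] at h1
      rw [eval_add, eval_finsetSum, heval, add_comm, ← h1]
      congr 1
      refine Finset.sum_congr rfl fun s _ => ?_
      rw [eval_mul, heval, Finset.sum_mul]
      refine Finset.sum_congr rfl fun t _ => ?_
      have h2 : f.eval (γ ^ ((i : ℕ) * m + (r + s))) = y i ⟨_, hrs r s⟩ := congrFun hi ⟨_, hrs r s⟩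
      rw [← h2, eval_comp, eval_mul, eval_C, eval_X, ← pow_add,
        show (s : ℕ) + (i * m + r) = i * m + (r + s) by ring]
      ring
  refine ⟨A, fun hA0 => ?_, fun f hf f' hf' => ⟨?_, ?_⟩⟩
  -- If all the `A s` vanished modulo `π`, the equation for `f₀` would make `A₀` vanish too, against
  -- the coefficient equal to `1`.
  · have hA : ∀ s, (A s).map φ = 0 := fun s => congrFun hA0 s
    have h1 := congrArg (Polynomial.map φ) (hzero f₀ hf₀)
    simp only [Polynomial.map_add, Polynomial.map_sum, Polynomial.map_mul, hA, zero_mul,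
      Finset.sum_const_zero, add_zero, Polynomial.map_zero] at h1
    rcases i₁ with ⟨s, t⟩ | t
    · have h2 := congrArg (fun q => q.coeff (t : ℕ)) (hA s)
      simp [A, hi₁] at h2
    · have h2 := congrArg (fun q => q.coeff (t : ℕ)) h1
      simp [A₀, hi₁] at h2
  · exact (degree_sub_le _ _).trans_lt (max_lt (hdeg f hf) (hdeg f' hf'))
  · have := congrArg₂ (· - ·) (hzero f hf) (hzero f' hf')
    simpa only [sub_comp, mul_sub, Finset.sum_sub_distrib, add_sub_add_left_eq_sub,
      sub_zero] using this

/-- The number of polynomials of a coset of `M` with large agreement is linear in the dimension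
of the socle reduction of `M`. -/
theorem card_le_of_sub_mem (h : IsChainReduction φ π) (hz : IsSocleGenerator φ π z)
    {γ : R} {b μ m N k : ℕ} (hg : Set.InjOn (φ γ ^ ·) (Set.Iio (m * N))) (hkn : k ≤ m * N)
    (hμ : μ + b = m + 1) (hb : 1 ≤ b) (y : Fin N → Fin m → R) {d : ℕ} (hd : d + 1 ≤ b)
    {M : Submodule R R[X]} (hM : M ≤ degreeLT R k)
    (hMd : Module.finrank F (socleReduction h.surjective z M) = d) {L : Finset R[X]}
    (hL : ∀ f ∈ L, ∀ f' ∈ L, f - f' ∈ M)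
    (hagr : ∀ f ∈ L, N * μ + b * k < (b + 1) * (μ * (agreement γ y f).card)) :
    L.card ≤ (b - 1) * d + 1 := by
  classical
  have hWk : ∀ {M : Submodule R R[X]}, M ≤ degreeLT R k →
      socleReduction h.surjective z M ≤ degreeLT F k := fun hM =>
    (socleReduction_mono h.surjective hM).trans (socleReduction_degreeLT_le h.surjective hz k)
  have hfinLT : FiniteDimensional F (degreeLT F k) :=
    Module.Finite.equiv (degreeLTEquiv F k).symm
  have hfin : ∀ {M : Submodule R R[X]}, M ≤ degreeLT R k →
      FiniteDimensional F (socleReduction h.surjective z M) := fun hM =>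
    Submodule.finiteDimensional_of_le (hWk hM)
  induction d using Nat.strong_induction_on generalizing M L with
  | _ d ih =>
  rcases Nat.eq_zero_or_pos d with rfl | hd0
  · have := hfin hM
    have hbot := eq_bot_of_socleReduction_eq_bot h hz (Submodule.finrank_eq_zero.1 hMd)
    rw [mul_zero, zero_add, Finset.card_le_one]
    intro f hf f' hf'
    have := hL f hf f' hf'
    rw [hbot] at this
    exact sub_eq_zero.1 (by simpa using this)
  by_contra! hlt
  set t := L.card with ht
  let Li : Fin N → Finset R[X] := fun i => L.filter fun f => i ∈ agreement γ y f
  let Mi : Fin N → Submodule R R[X] := fun i => M ⊓ blockVanishing γ m i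
  let di : Fin N → ℕ := fun i => Module.finrank F (socleReduction h.surjective z (Mi i))
  let W := socleReduction h.surjective z M
  have hdi : ∀ i : Fin N, di i ≤
      Module.finrank F (W ⊓ blockVanishing (φ γ) m i : Submodule F F[X]) := by
    intro i
    have : FiniteDimensional F W := hfin hM
    refine Submodule.finrank_mono (le_inf ?_ ?_)
    · exact socleReduction_mono h.surjective inf_le_left
    · exact (socleReduction_mono h.surjective inf_le_right).trans
        (socleReduction_blockVanishing_le h.surjective hz γ m i)
  have hdid : ∀ i, di i ≤ d := by
    intro i
    have : FiniteDimensional F W := hfin hM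
    rw [← hMd]
    exact Submodule.finrank_mono (socleReduction_mono h.surjective inf_le_left)
  -- One linear bound covers both cases: the line through `(0, 1)` and `(d, t)` has slope at least
  -- `b - 1` because `t > (b - 1) * d + 1`, so it dominates the inductive bound for `di i < d` and
  -- the trivial bound `t` for `di i = d`.
  have hLi : ∀ i, d * (Li i).card ≤ d + (t - 1) * di i := by
    intro i
    rcases (hdid i).lt_or_eq with hlt' | heq
    · have h1 : (Li i).card ≤ (b - 1) * di i + 1 := by
        refine ih (di i) hlt' (by omega) (M := Mi i) (inf_le_left.trans hM) rfl ?_ ?_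
        · intro f hf f' hf'
          rw [Finset.mem_filter] at hf hf'
          refine ⟨hL f hf.1 f' hf'.1, fun j hj => ?_⟩
          have h1 := congrFun (mem_agreement.1 hf.2) ⟨j, hj⟩
          have h2 := congrFun (mem_agreement.1 hf'.2) ⟨j, hj⟩
          rw [eval_sub, sub_eq_zero]
          exact h1.trans h2.symm
        · exact fun f hf => hagr f (Finset.mem_filter.1 hf).1
      calc d * (Li i).card ≤ d * ((b - 1) * di i + 1) := Nat.mul_le_mul_left _ h1
        _ = d + ((b - 1) * d) * di i := by ring
        _ ≤ d + (t - 1) * di i := by gcongr; omega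
    · have h1 : (Li i).card ≤ t := Finset.card_filter_le _ _
      rw [heq]
      calc d * (Li i).card ≤ d * t := Nat.mul_le_mul_left _ h1
        _ = d * (1 + (t - 1)) := by rw [show 1 + (t - 1) = t by omega]
        _ = d + (t - 1) * d := by ring
  have hD : μ * ∑ i, di i ≤ d * k := by
    refine le_trans ?_ (sum_finrank_inf_blockVanishing_le hg hkn (hWk hM) hMd (by omega))
    gcongr
    · omega
    · exact hdi _
  have hdc : ∑ f ∈ L, (agreement γ y f).card = ∑ i, (Li i).card := by
    have : ∀ f, agreement γ y f = Finset.univ.filter fun i => i ∈ agreement γ y f := by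
      intro f; ext; simp
    rw [Finset.sum_congr rfl fun f _ => congrArg Finset.card (this f)]
    exact Finset.sum_card_bipartiteAbove_eq_sum_card_bipartiteBelow _
  have hsum1 : t * (N * μ + b * k) < (b + 1) * (μ * ∑ i, (Li i).card) := by
    rw [← hdc, Finset.mul_sum, Finset.mul_sum, ht, ← smul_eq_mul, ← Finset.sum_const]
    refine Finset.sum_lt_sum_of_nonempty ?_ hagr
    rw [← Finset.card_pos]; omega
  have hsum2 : d * ∑ i, (Li i).card ≤ N * d + (t - 1) * ∑ i, di i := by
    rw [Finset.mul_sum, Finset.mul_sum]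
    refine (Finset.sum_le_sum fun i _ => hLi i).trans ?_
    simp [Finset.sum_add_distrib]
  have hsum3 : d * (t * (N * μ + b * k)) < d * ((b + 1) * (N * μ + (t - 1) * k)) := by
    calc d * (t * (N * μ + b * k)) < d * ((b + 1) * (μ * ∑ i, (Li i).card)) := by gcongr
      _ = (b + 1) * (μ * (d * ∑ i, (Li i).card)) := by ring
      _ ≤ (b + 1) * (μ * (N * d + (t - 1) * ∑ i, di i)) := by gcongr
      _ = (b + 1) * (μ * (N * d) + (t - 1) * (μ * ∑ i, di i)) := by ring
      _ ≤ (b + 1) * (μ * (N * d) + (t - 1) * (d * k)) := by gcongr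
      _ = _ := by ring
  -- The inequality rearranges to `(t - b - 1) * (N * μ) < (t - b - 1) * k`, which is impossible
  -- since `b + 1 ≤ t` and `k ≤ N * μ`.
  have hsum4 := lt_of_mul_lt_mul_left hsum3 (Nat.zero_le d)
  have htb : b + 1 ≤ t := by
    have : (b - 1) * 1 ≤ (b - 1) * d := Nat.mul_le_mul_left _ hd0
    omega
  have hkN : k ≤ N * μ := by
    obtain ⟨f₀, hf₀⟩ : L.Nonempty := by rw [← Finset.card_pos]; omega
    have h1 := hagr f₀ hf₀
    have h2 : (agreement γ y f₀).card ≤ N := by simpa using Finset.card_le_univ (agreement γ y f₀)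
    exact le_mul_of_mul_add_lt h1 h2
  obtain ⟨u, hu⟩ := Nat.exists_eq_add_of_le htb
  rw [hu] at hsum4
  rw [show b + 1 + u - 1 = b + u by omega] at hsum4
  have := Nat.mul_le_mul_left u hkN
  nlinarith

/-- The list size bound for folded Reed-Solomon codes over a finite chain ring. -/
theorem card_le_of_card_agreement (h : IsChainReduction φ π)
    {γ : R} {b μ m N k : ℕ} (hg : Set.InjOn (φ γ ^ ·) (Set.Iio (m * N))) (hk : 1 ≤ k)
    (hkn : k ≤ m * N) (hμ : μ + b = m + 1) (hb : 1 ≤ b) (y : Fin N → Fin m → R)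
    {L : Finset R[X]} (hdeg : ∀ f ∈ L, f.degree < (k : WithBot ℕ))
    (hagr : ∀ f ∈ L, N * μ + b * k < (b + 1) * (μ * (agreement γ y f).card)) :
    L.card ≤ (b - 1) ^ 2 + 1 := by
  rcases L.eq_empty_or_nonempty with rfl | hL0
  · simp
  obtain ⟨z, hz⟩ := h.exists_isSocleGenerator
  obtain ⟨A, hA, hL⟩ := exists_dilation_equation h hz hg hk hμ hb y hL0 hdeg hagr
  have hfin : FiniteDimensional F (dilationSolutions (φ γ) (fun s => (A s).map φ) k) := by
    have : FiniteDimensional F (degreeLT F k) := Module.Finite.equiv (degreeLTEquiv F k).symm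
    exact Submodule.finiteDimensional_of_le (dilationSolutions_le_degreeLT _ _ k)
  have h1 := Submodule.finrank_mono
    (socleReduction_dilationSolutions_le (π := π) h.surjective hz γ A k)
  have h2 := finrank_dilationSolutions_lt (hg.mono fun x hx => lt_of_lt_of_le hx hkn) hA
  have h3 := card_le_of_sub_mem h hz hg hkn hμ hb y (by omega)
    (dilationSolutions_le_degreeLT γ A k) rfl hL hagr
  refine h3.trans ?_
  rw [sq]
  gcongr
  omega

end Chain

/-! ### The Galois ring as a chain ring -/

theorem exists_isChainReduction_galoisRing {p a ℓ : ℕ} (hp : p.Prime) (ha : 1 ≤ a)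
    {h : (ZMod (p ^ a))[X]} (hh : IsMonicBasicIrreducible p a ℓ ha h) :
    ∃ (F : Type) (_ : Field F) (φ : GaloisRing p a h →+* F),
      IsChainReduction φ (p : GaloisRing p a h) := by
  have : Fact p.Prime := ⟨hp⟩
  set red := ZMod.castHom (dvd_pow_self p (Nat.one_le_iff_ne_zero.mp ha)) (ZMod p) with hred
  have hirr : Fact (Irreducible (h.map red)) := ⟨hh.irreducible_mod⟩
  have hredsurj : Function.Surjective red := ZMod.castHom_surjective _
  let φ : GaloisRing p a h →+* AdjoinRoot (h.map red) := AdjoinRoot.map red h (h.map red) dvd_rfl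
  have hφ : ∀ g, φ (AdjoinRoot.mk h g) = AdjoinRoot.mk (h.map red) (g.map red) := by
    intro g
    change (φ.comp (AdjoinRoot.mk h)) g = ((AdjoinRoot.mk (h.map red)).comp (mapRingHom red)) g
    congr 1
    refine Polynomial.ringHom_ext (fun x => ?_) ?_ <;> simp [φ]
  have hpC : (p : GaloisRing p a h) = AdjoinRoot.mk h (C (p : ZMod (p ^ a))) := by simp
  refine ⟨AdjoinRoot (h.map red), inferInstance, φ, ?_, ⟨a, ?_⟩, ?_⟩
  · intro x
    obtain ⟨q, rfl⟩ := AdjoinRoot.mk_surjective x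
    obtain ⟨g, rfl⟩ := map_surjective red hredsurj q
    exact ⟨AdjoinRoot.mk h g, hφ g⟩
  · rw [hpC, ← map_pow, ← C_pow, ← Nat.cast_pow, ZMod.natCast_self, C_0, map_zero]
  · intro r
    constructor
    · intro hr
      obtain ⟨g, rfl⟩ := AdjoinRoot.mk_surjective r
      rw [hφ, AdjoinRoot.mk_eq_zero] at hr
      obtain ⟨q, hq⟩ := hr
      obtain ⟨q, rfl⟩ := map_surjective red hredsurj q
      -- With the quotient by the reduced `h` lifted to `q`, every coefficient of `g - h * q`
      -- vanishes modulo `p`.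
      have hdvd : C (p : ZMod (p ^ a)) ∣ g - h * q := by
        rw [C_dvd_iff_dvd_coeff]
        intro i
        have h1 : red ((g - h * q).coeff i) = 0 := by
          rw [← coeff_map, Polynomial.map_sub, Polynomial.map_mul, hq, sub_self, coeff_zero]
        have : NeZero (p ^ a) := ⟨pow_ne_zero _ hp.ne_zero⟩
        generalize (g - h * q).coeff i = c at h1
        rw [← ZMod.natCast_zmod_val c, map_natCast, ZMod.natCast_eq_zero_iff] at h1
        rw [← ZMod.natCast_zmod_val c]
        exact Nat.cast_dvd_cast h1
      have := map_dvd (AdjoinRoot.mk h) hdvd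
      rwa [map_sub, map_mul, AdjoinRoot.mk_self, zero_mul, sub_zero, ← hpC] at this
    · rintro ⟨s, rfl⟩
      have : φ (p : GaloisRing p a h) = 0 := by
        rw [hpC, hφ]
        simp
      rw [map_mul, this, zero_mul]

theorem finite_galoisRing {p a : ℕ} (hp : p.Prime) {h : (ZMod (p ^ a))[X]} (hh : h.Monic) :
    Finite (GaloisRing p a h) := by
  have : NeZero (p ^ a) := ⟨pow_ne_zero _ hp.ne_zero⟩
  have : Module.Finite (ZMod (p ^ a)) (AdjoinRoot h) := hh.finite_adjoinRoot
  exact Module.finite_of_finite (ZMod (p ^ a))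

/-- The powers of an element of order `p ^ ℓ - 1` remain distinct modulo `p`. -/
theorem injOn_pow_map_of_orderOf_eq {R F : Type*} [CommRing R] [Field F] {φ : R →+* F} {p ℓ : ℕ}
    (hp : p.Prime) (h : IsChainReduction φ (p : R)) {γ : R} (hγ : orderOf γ = p ^ ℓ - 1) {n : ℕ}
    (hn : n ≤ p ^ ℓ - 1) : Set.InjOn (φ γ ^ ·) (Set.Iio n) := by
  intro x hx y hy hxy
  simp only [Set.mem_Iio] at hx hy hxy
  obtain ⟨a, ha⟩ := h.isNilpotent
  have h1 : φ (γ ^ x - γ ^ y) = 0 := by simp [hxy]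
  -- Raising to the power `p ^ a` turns a congruence modulo `p` into one modulo `p ^ (a + 1)`, here
  -- an equality. As `p ^ a` is prime to the order of `γ`, it cancels from the exponents.
  have h2 := dvd_sub_pow_of_dvd_sub ((h.map_eq_zero_iff _).1 h1) a
  rw [pow_succ, ha, zero_mul, zero_dvd_iff, sub_eq_zero, ← pow_mul, ← pow_mul] at h2
  have hfin : IsOfFinOrder γ := orderOf_pos_iff.1 (by omega)
  rw [hfin.pow_eq_pow_iff_modEq, hγ] at h2
  have hcop : Nat.Coprime (p ^ ℓ - 1) (p ^ a) := by
    refine Nat.Coprime.pow_right a (Nat.Coprime.symm (hp.coprime_iff_not_dvd.2 fun hdvd => ?_))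
    have hℓ : ℓ ≠ 0 := by
      rintro rfl
      simp at hn
      omega
    have h3 := (Nat.dvd_sub_iff_right (by omega : p ^ ℓ - 1 ≤ p ^ ℓ) (dvd_pow_self p hℓ)).2 hdvd
    rw [show p ^ ℓ - (p ^ ℓ - 1) = 1 by omega] at h3
    exact hp.one_lt.ne' (Nat.dvd_one.1 h3)
  exact (h2.cancel_right_of_coprime hcop).eq_of_lt_of_lt (by omega) (by omega)

/-! ### Rate, decoding radius and the Singleton bound -/

section Chain

variable {R F : Type*} [CommRing R] [Field F] {φ : R →+* F} {π : R}

theorem injOn_frsEncode (h : IsChainReduction φ π) {γ : R} {m N k : ℕ}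
    (hg : Set.InjOn (φ γ ^ ·) (Set.Iio (m * N))) (hkn : k ≤ m * N) :
    Set.InjOn (frsEncode γ m N) {f : R[X] | f.degree < (k : WithBot ℕ)} := by
  intro f hf f' hf' heq
  obtain ⟨z, hz⟩ := h.exists_isSocleGenerator
  rw [← sub_eq_zero]
  refine hz.eq_zero_of_degree_lt_card h (S := (Finset.univ : Finset (Fin N × Fin m)))
    (x := fun x => γ ^ ((x.1 : ℕ) * m + x.2)) ?_ ?_ ?_
  · rintro ⟨i, r⟩ - ⟨i', r'⟩ - hxx
    simp only [map_pow] at hxx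
    have h2 := block_index_injective r.2 r'.2
      (hg (block_index_lt i.2 r.2) (block_index_lt i'.2 r'.2) hxx)
    exact Prod.ext (Fin.ext h2.1) (Fin.ext h2.2)
  · refine ((degree_sub_le _ _).trans_lt (max_lt hf hf')).trans_le ?_
    rw [Finset.card_univ, Fintype.card_prod, Fintype.card_fin, Fintype.card_fin]
    exact WithBot.coe_le_coe.2 (by rwa [mul_comm])
  · rintro ⟨i, r⟩ -
    rw [eval_sub, sub_eq_zero]
    exact congrFun (congrFun heq i) r

theorem codeRate_frsCode [Finite R] (h : IsChainReduction φ π) {γ : R} {m N k : ℕ}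
    (hg : Set.InjOn (φ γ ^ ·) (Set.Iio (m * N))) (hkn : k ≤ m * N) :
    codeRate (frsCode γ m N k) = (k : ℝ) / ((m : ℝ) * N) := by
  have : Nontrivial R := φ.domain_nontrivial
  have hq : (1 : ℝ) < Nat.card R := by exact_mod_cast Finite.one_lt_card
  have h1 : (frsCode γ m N k).ncard = Nat.card R ^ k := by
    rw [frsCode, (injOn_frsEncode h hg hkn).ncard_image]
    have h2 : {f : R[X] | f.degree < (k : WithBot ℕ)} = (degreeLT R k : Set R[X]) := by
      ext f
      exact mem_degreeLT.symm
    rw [h2, ← Nat.card_coe_set_eq]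
    exact (Nat.card_congr (degreeLTEquiv R k).toEquiv).trans (by simp [Nat.card_fun])
  have hlog : Real.log (Nat.card R) ≠ 0 := (Real.log_pos hq).ne'
  rw [codeRate, h1, Nat.card_fun, Nat.card_fin, Nat.cast_pow, Nat.cast_pow, Real.logb,
    Real.log_pow, Real.log_pow, mul_div_mul_right _ _ hlog, div_div]

theorem card_agreement_add_hammingDist [DecidableEq R] (γ : R) {m N : ℕ} (y : Fin N → Fin m → R)
    (f : R[X]) : (agreement γ y f).card + hammingDist y (frsEncode γ m N f) = N := by
  classical
  rw [agreement, hammingDist]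
  simp only [eq_comm (b := y _), ne_eq]
  convert Finset.card_filter_add_card_filter_not (s := (Finset.univ : Finset (Fin N)))
    fun i => y i = frsEncode γ m N f i
  simp

theorem encard_decodingList_frsCode_le [Finite R] (h : IsChainReduction φ π) {γ : R}
    {b m N k : ℕ} (hg : Set.InjOn (φ γ ^ ·) (Set.Iio (m * N))) (hk : 1 ≤ k) (hkn : k ≤ m * N)
    (hb : 1 ≤ b) (hbm : b ≤ m) (y : Fin N → Fin m → R) :
    (decodingList (frsCode γ m N k) y ((b : ℝ) / ((b : ℝ) + 1) *
      (1 - (m : ℝ) / ((m : ℝ) - (b : ℝ) + 1) * codeRate (frsCode γ m N k)))).encard ≤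
        (((b - 1) ^ 2 + 1 : ℕ) : ℕ∞) := by
  classical
  rw [codeRate_frsCode h hg hkn]
  set δ : ℝ := (b : ℝ) / ((b : ℝ) + 1) *
    (1 - (m : ℝ) / ((m : ℝ) - (b : ℝ) + 1) * ((k : ℝ) / ((m : ℝ) * N))) with hδ
  obtain ⟨μ, hμ⟩ : ∃ μ, μ + b = m + 1 := ⟨m + 1 - b, by omega⟩
  set S := decodingList (frsCode γ m N k) y δ with hS
  have hSfin : S.Finite := Set.toFinite S
  have hpre : ∀ c ∈ S, ∃ f : R[X], f.degree < (k : WithBot ℕ) ∧ frsEncode γ m N f = c :=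
    fun c hc => hc.1
  choose! g hgdeg hgc using hpre
  have hcard : (hSfin.toFinset.image g).card = hSfin.toFinset.card := by
    refine Finset.card_image_of_injOn fun c hc c' hc' hcc => ?_
    rw [← hgc c (by simpa using hc), ← hgc c' (by simpa using hc'), hcc]
  rw [hSfin.encard_eq_coe_toFinset_card, Nat.cast_le, ← hcard]
  refine card_le_of_card_agreement h hg hk hkn hμ hb y ?_ ?_
  · intro f hf
    obtain ⟨c, hc, rfl⟩ := Finset.mem_image.1 hf
    exact hgdeg c (by simpa using hc)
  · intro f hf
    obtain ⟨c, hc, rfl⟩ := Finset.mem_image.1 hf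
    have hcS : c ∈ S := by simpa using hc
    have h1 : ((hammingDist y c : ℕ) : ℝ) < δ * N := by
      convert hcS.2
    have h2 := card_agreement_add_hammingDist γ y (g c)
    rw [hgc c hcS] at h2
    have h3 : ((agreement γ y (g c)).card : ℝ) + (hammingDist y c : ℕ) = N := by exact_mod_cast h2
    have hN : (0 : ℝ) < N := by
      rcases Nat.eq_zero_or_pos N with rfl | hN
      · omega
      · exact_mod_cast hN
    have hm : (0 : ℝ) < m := by exact_mod_cast (by omega : 0 < m)
    have hμR : (m : ℝ) - b + 1 = μ := by
      have : (μ : ℝ) + b = m + 1 := by exact_mod_cast hμ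
      linarith
    have hμ0 : (0 : ℝ) < μ := by exact_mod_cast (by omega : 0 < μ)
    -- Clearing denominators turns the radius into the integer agreement condition, since the rate
    -- is `k / (m * N)`.
    have hδN : (b + 1) * (μ * (δ * N)) = b * (μ * N) - b * k := by
      rw [hδ, hμR]
      field_simp
    have h4 : ((b : ℝ) + 1) * (μ * (hammingDist y c : ℕ)) < (b + 1) * (μ * (δ * N)) := by gcongr
    rw [hδN, eq_sub_of_add_eq' h3] at h4
    have h5 : (N : ℝ) * μ + b * k < (b + 1) * (μ * (agreement γ y (g c)).card) := by linarith
    exact_mod_cast h5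

theorem decodingList_mono {A : Type*} {N : ℕ} (C : Set (Fin N → A)) (y : Fin N → A) {δ δ' : ℝ}
    (hδ : δ ≤ δ') : decodingList C y δ ⊆ decodingList C y δ' :=
  fun _ hc => ⟨hc.1, hc.2.trans_le (mul_le_mul_of_nonneg_right hδ (Nat.cast_nonneg N))⟩

/-- Near the Singleton bound, the list size is `O(1 / ε ^ 2)`. -/
theorem ncard_decodingList_frsCode_le [Finite R] (h : IsChainReduction φ π) {γ : R}
    {m N k : ℕ} (hg : Set.InjOn (φ γ ^ ·) (Set.Iio (m * N))) (hk : 1 ≤ k) (hkn : k ≤ m * N)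
    {ε : ℝ} (hε : 0 < ε) (hm : 6 / ε ^ 2 ≤ (m : ℝ)) (y : Fin N → Fin m → R) :
    ((decodingList (frsCode γ m N k) y (1 - codeRate (frsCode γ m N k) - ε)).ncard : ℝ) ≤
      5 / ε ^ 2 := by
  have hn0 : (0 : ℝ) < (m : ℝ) * N := by exact_mod_cast (by omega : 0 < m * N)
  have hR0 : 0 < codeRate (frsCode γ m N k) := by
    rw [codeRate_frsCode h hg hkn]
    have : (0 : ℝ) < k := by exact_mod_cast hk
    positivity
  have hR1 : codeRate (frsCode γ m N k) ≤ 1 := by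
    rw [codeRate_frsCode h hg hkn, div_le_one hn0]
    exact_mod_cast hkn
  have hbound := fun (b : ℕ) (hb : 1 ≤ b) (hbm : b ≤ m) =>
    encard_decodingList_frsCode_le h hg hk hkn hb hbm y
  generalize codeRate (frsCode γ m N k) = ρ at *
  -- For `1 ≤ ε` the radius is negative and the list is empty.
  rcases le_or_gt 1 ε with hε1 | hε1
  · have hempty : decodingList (frsCode γ m N k) y (1 - ρ - ε) = ∅ := by
      rw [Set.eq_empty_iff_forall_notMem]
      rintro c ⟨-, hc⟩
      have h1 : (1 - ρ - ε) * (N : ℝ) ≤ 0 :=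
        mul_nonpos_of_nonpos_of_nonneg (by linarith) (Nat.cast_nonneg N)
      exact absurd (hc.trans_le h1) (Nat.cast_nonneg _).not_gt
    rw [hempty, Set.ncard_empty, Nat.cast_zero]
    positivity
  set b := ⌈2 / ε⌉₊ with hbdef
  have hb2 : 2 / ε ≤ b := Nat.le_ceil _
  have hb3 : (b : ℝ) < 2 / ε + 1 := Nat.ceil_lt_add_one (by positivity)
  have hinv : 1 < 1 / ε := (one_lt_div hε).2 hε1
  set w := 1 / ε with hw
  have e2 : 2 / ε = 2 * w := by rw [hw]; ring
  have e6 : 6 / ε ^ 2 = 6 * w ^ 2 := by rw [hw]; ring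
  have e5 : 5 / ε ^ 2 = 5 * w ^ 2 := by rw [hw]; ring
  have hεw : ε * w = 1 := by rw [hw]; field_simp
  rw [e2] at hb2 hb3
  rw [e6] at hm
  rw [e5]
  have hb1R : (1 : ℝ) < b := by linarith
  have hb1 : 1 ≤ b := by exact_mod_cast hb1R.le
  have hbmR : (b : ℝ) ≤ m := by nlinarith
  have hbm : b ≤ m := by exact_mod_cast hbmR
  -- The loss splits into `1 / (b + 1)` and `(b - 1) / (m - b + 1)`, each at most `ε / 2`: the first
  -- because `b ≥ 2 / ε`, the second because `b - 1 < 2 / ε` and `m ≥ 6 / ε ^ 2` leaves `m - b + 1 ≥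
  -- 4 / ε ^ 2`.
  have hδ : 1 - ρ - ε ≤ (b : ℝ) / ((b : ℝ) + 1) * (1 - (m : ℝ) / ((m : ℝ) - (b : ℝ) + 1) * ρ) := by
    have hμ : (4 : ℝ) * w ^ 2 ≤ m - b + 1 := by nlinarith
    have hμ0 : (0 : ℝ) < m - b + 1 := by linarith
    have h1 : 1 / ((b : ℝ) + 1) ≤ ε / 2 := by
      rw [div_le_div_iff₀ (by linarith) (by norm_num)]
      nlinarith
    have h2 : ((b : ℝ) - 1) / (m - b + 1) ≤ ε / 2 := by
      rw [div_le_div_iff₀ hμ0 (by norm_num)]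
      have : ε * (4 * w ^ 2) ≤ ε * (m - b + 1) := by gcongr
      have : ε * (4 * w ^ 2) = 4 * w := by linear_combination 4 * w * hεw
      linarith
    have h3 : (b : ℝ) / (b + 1) = 1 - 1 / (b + 1) := by field_simp; ring
    have h4 : (m : ℝ) / (m - b + 1) = 1 + (b - 1) / (m - b + 1) := by field_simp; ring
    have h5 : 0 ≤ 1 / ((b : ℝ) + 1) := by positivity
    have h6 : 0 ≤ ((b : ℝ) - 1) / (m - b + 1) := div_nonneg (by linarith) hμ0.le
    rw [h3, h4]
    generalize 1 / ((b : ℝ) + 1) = s at *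
    generalize ((b : ℝ) - 1) / (m - b + 1) = u at *
    nlinarith [mul_nonneg h5 hR0.le, mul_nonneg h6 hR0.le, mul_nonneg h5 (mul_nonneg h6 hR0.le),
      mul_nonneg h6 (sub_nonneg.2 hR1)]
  have hfinal := (Set.encard_le_encard (decodingList_mono (frsCode γ m N k) y hδ)).trans
    (hbound b hb1 hbm)
  rw [Set.encard_le_coe_iff_finite_ncard_le] at hfinal
  have hc : ((decodingList (frsCode γ m N k) y (1 - ρ - ε)).ncard : ℝ) ≤
      ((b - 1) ^ 2 + 1 : ℕ) := by exact_mod_cast hfinal.2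
  refine hc.trans ?_
  rw [Nat.cast_add, Nat.cast_pow, Nat.cast_sub hb1, Nat.cast_one]
  -- With `b - 1 < 2 * w` and `1 < w`, the bound is at most `4 * w ^ 2 + 1 ≤ 5 * w ^ 2`.
  nlinarith

end Chain

theorem mainTheorem2 :
    (∀ (p a ℓ : ℕ) (_hp : p.Prime) (ha : 1 ≤ a) (h : (ZMod (p ^ a))[X])
        (_hh : IsMonicBasicIrreducible p a ℓ ha h)
        (γ : GaloisRing p a h) (_hγ : orderOf γ = p ^ ℓ - 1)
        (m N k : ℕ) (_hn : m * N ≤ p ^ ℓ - 1) (_hk : 1 ≤ k) (_hkn : k ≤ m * N)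
        (b : ℕ) (_hb : 1 ≤ b) (_hbm : b ≤ m)
        (R : ℝ) (_hR : R = codeRate (frsCode γ m N k))
        (y : Fin N → Fin m → GaloisRing p a h),
        (decodingList (frsCode γ m N k) y
          ((b : ℝ) / ((b : ℝ) + 1) * (1 - (m : ℝ) / ((m : ℝ) - (b : ℝ) + 1) * R))).encard
            ≤ (((b - 1) ^ 2 + 1 : ℕ) : ℕ∞)) ∧
    (∃ c K : ℝ, 0 < c ∧ 0 < K ∧
      ∀ (ε : ℝ) (_hε : 0 < ε)
        (p a ℓ : ℕ) (_hp : p.Prime) (ha : 1 ≤ a) (h : (ZMod (p ^ a))[X])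
        (_hh : IsMonicBasicIrreducible p a ℓ ha h)
        (γ : GaloisRing p a h) (_hγ : orderOf γ = p ^ ℓ - 1)
        (m N k : ℕ) (_hn : m * N ≤ p ^ ℓ - 1) (_hk : 1 ≤ k) (_hkn : k ≤ m * N)
        (_hm : c / ε ^ 2 ≤ (m : ℝ))
        (R : ℝ) (_hR : R = codeRate (frsCode γ m N k))
        (y : Fin N → Fin m → GaloisRing p a h),
        (decodingList (frsCode γ m N k) y (1 - R - ε)).Finite ∧
          ((decodingList (frsCode γ m N k) y (1 - R - ε)).ncard : ℝ) ≤ K / ε ^ 2) := by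

  refine ⟨?_, 6, 5, by norm_num, by norm_num, ?_⟩
  · intro p a ℓ hp ha h hh γ hγ m N k hn hk hkn b hb hbm R hR y
    obtain ⟨F, _, φ, hφ⟩ := exists_isChainReduction_galoisRing hp ha hh
    have := finite_galoisRing hp hh.monic
    rw [hR]
    exact encard_decodingList_frsCode_le hφ (injOn_pow_map_of_orderOf_eq hp hφ hγ hn) hk hkn hb
      hbm y
  · intro ε hε p a ℓ hp ha h hh γ hγ m N k hn hk hkn hm R hR y
    obtain ⟨F, _, φ, hφ⟩ := exists_isChainReduction_galoisRing hp ha hh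
    have := finite_galoisRing hp hh.monic
    rw [hR]
    exact ⟨Set.toFinite _, ncard_decodingList_frsCode_le hφ
      (injOn_pow_map_of_orderOf_eq hp hφ hγ hn) hk hkn hε hm y⟩
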